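/- Fix an integer $K \ge 0$ and a probability space. For an integer $d$ and a sequence $x = (x_n)_{n\in\mathbb Z}$ of vectors of $\mathbb C^d$, and for integers $N \ge 1$, $B \ge 0$ with $B$ even and $\nu \in \mathbb R$, put $$\xi_x(\nu) = \frac{1}{\sqrt N}\sum_{n=0}^{N-1} x_n e^{-2i\pi\nu n}, \qquad \Sigma_x(\nu) = \frac{1}{\sqrt{B+1}}\Bigl[\xi_x\bigl(\nu - \tfrac{B}{2N}\bigr), \xi_x\bigl(\nu - \tfrac{B}{2N} + \tfrac1N\bigr), \ldots, \xi_x\bigl(\nu+\tfrac{B}{2N}\bigr)\Bigr] \in \mathbb C^{d\times(B+1)} .$$ Let $\|\cdot\|_2$ be the spectral norm of matrices (Euclidean norm of vectors). For each $M\ge 1$ let $(\mathbf H_k)_{k\in\mathbb Z} = (\mathbf H_k^{(M)})_{k \in \mathbb Z}$ be a filter with $\mathbf H_k\in\mathbb C^{M\times K}$, let $\mathbf H(\nu)=\sum_{k\in\mathbb Z}\mathbf H_k e^{-2i\pi\nu k}$, with rows $\mathbf h^1(\nu),\dots,\mathbf h^M(\nu)$, and assume $$\sup_{M\ge1}\sum_{k\in\mathbb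 Z}(1+|k|)\,\|\mathbf H_k\|_2<\infty, \qquad \lim_{M\to\infty}\max_{m=1,\dots,M}\max_{\nu\in[0,1]}\|\mathbf h^m(\nu)\|_2=0 .$$ For each $M \ge 1$ let $(\boldsymbol\epsilon_n)_{n\in\mathbb Z}$ be a $K$-dimensional complex Gaussian white noise, i.e. the $\boldsymbol\epsilon_n$ are independent and $\boldsymbol\epsilon_n \sim \mathcal N_{\mathbb C^K}(\mathbf 0, \mathbf I_K)$ (circular), defined on the fixed probability space. It may be the same noise for all $M$, or depend on $M$, in which case nothing is assumed on the joint law of the noises for different $M$. Let $(\mathbf u_n)_{n\in\mathbb Z}$ be the $M$-dimensional process such that, for each $n$, $$\mathbf u_n=\sum_{k\in\mathbb Z}\mathbf H_k\boldsymbol\epsilon_{n-k}\quad\text{with probability one.}$$ Let $N=N(M)$ and $B=B(M)$ be integer-valued functions of $M$, with $B$ even, such that for some $\alpha\in(0,1)$ and some $c\in(0,1)$ $$M=\mathcal O(N^\alpha)\quad\text{and}\quad \frac MB\xrightarrow[M\to\infty]{}c,$$ and let $\mathcal V_N=\{k/N : k=0,\dots,N-1\}$ be the set of Fourier frequencies.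 Then, almost surely, $$\max_{\nu\in\mathcal V_N}\bigl\|\Sigma_{\mathbf u}(\nu)-\mathbf H(\nu)\,\Sigma_{\boldsymbol\epsilon}(\nu)\bigr\|_2\xrightarrow[M\to\infty]{}0 .$$ -/

import Mathlib

open MeasureTheory ProbabilityTheory Filter Topology Asymptotics
open scoped NNReal Matrix Matrix.Norms.L2Operator

-- Matrices carry the spectral norm (the operator norm between Euclidean spaces).

noncomputable section

/-- The circular complex Gaussian distribution with mean `0` and variance `v`: the real and
imaginary parts are independent, centred, real Gaussian of variance `v / 2`. -/
def complexGaussian (v : ℝ≥0) : Measure ℂ :=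
  ((gaussianReal 0 (v / 2)).prod (gaussianReal 0 (v / 2))).map fun p => (⟨p.1, p.2⟩ : ℂ)

/-- The random vector `x` is circular complex Gaussian, centred with covariance matrix `R`:
for every deterministic vector `b`, the scalar `b^* x` is circular complex Gaussian with
variance `b^* R b`. -/
def IsComplexGaussianVector {Ω : Type*} [MeasurableSpace Ω] {K : ℕ} (x : Ω → Fin K → ℂ)
    (R : Matrix (Fin K) (Fin K) ℂ) (P : Measure Ω) : Prop :=
  ∀ b : Fin K → ℂ,
    HasLaw (fun ω => star b ⬝ᵥ x ω) (complexGaussian (star b ⬝ᵥ R *ᵥ b).re.toNNReal) P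

/-- `(ε n)`, `n ∈ ℤ`, is a `K`-dimensional complex Gaussian white noise with
`𝔼[ε n (ε n)^*] = I`: independent random vectors, each circular complex Gaussian, centred,
with identity covariance matrix. -/
structure IsComplexGaussianWhiteNoise {Ω : Type*} [MeasurableSpace Ω] {K : ℕ}
    (ε : ℤ → Ω → Fin K → ℂ) (P : Measure Ω) : Prop where
  measurable : ∀ n, Measurable (ε n)
  indep : iIndepFun ε P
  gaussian : ∀ n, IsComplexGaussianVector (ε n) 1 P

/-- The phase `exp (-2 i π ν n)`. -/
def phase (ν : ℝ) (n : ℤ) : ℂ :=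
  Complex.exp (-(2 * Real.pi * Complex.I * ν * n))

/-- The Fourier transform `H(ν) = ∑ k ∈ ℤ, H_k exp (-2 i π ν k)` of a matrix filter. -/
def transferFunction {M K : ℕ} (H : ℤ → Matrix (Fin M) (Fin K) ℂ) (ν : ℝ) :
    Matrix (Fin M) (Fin K) ℂ :=
  ∑' k : ℤ, phase ν k • H k

/-- The Euclidean norm of row `m` of a matrix. -/
def rowNorm {M K : ℕ} (A : Matrix (Fin M) (Fin K) ℂ) (m : Fin M) : ℝ :=
  ‖(WithLp.toLp 2 (fun j => A m j) : EuclideanSpace ℂ (Fin K))‖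

/-- The conditions on the family of MIMO filters `(H M k)`, `k ∈ ℤ`, indexed by `M`. -/
structure MIMOFilterConditions {K : ℕ} (H : (M : ℕ) → ℤ → Matrix (Fin M) (Fin K) ℂ) : Prop where
  /-- `sup_{M ≥ 1} ∑_k (1 + |k|) ‖H_k‖₂ < ∞` -/
  memory : ∃ C : ℝ, ∀ M : ℕ, 1 ≤ M →
    Summable (fun k : ℤ => (1 + |(k : ℝ)|) * ‖H M k‖) ∧
      ∑' k : ℤ, (1 + |(k : ℝ)|) * ‖H M k‖ ≤ C
  /-- `max_m max_{ν ∈ [0,1]} ‖h^m(ν)‖₂ → 0` as `M → ∞`, with `h^m(ν)` the rows of `H(ν)` -/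
  power : Tendsto
    (fun M : ℕ => ⨆ m : Fin M, ⨆ ν : Set.Icc (0 : ℝ) 1, rowNorm (transferFunction (H M) ν) m)
    atTop (𝓝 0)

/-- The high-dimensional regime for the sample size `N = N(M)` and the (even) smoothing span
`B = B(M)`. -/
structure HighDimensionalRegime (N B : ℕ → ℕ) : Prop where
  even_span : ∀ M, Even (B M)
  sample_size : ∃ α : ℝ, 0 < α ∧ α < 1 ∧
    (fun M : ℕ => (M : ℝ)) =O[atTop] fun M : ℕ => (N M : ℝ) ^ α
  ratio : ∃ c : ℝ, 0 < c ∧ c < 1 ∧ Tendsto (fun M : ℕ => (M : ℝ) / (B M : ℝ)) atTop (𝓝 c)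

/-- The set of Fourier frequencies `{k / N : k = 0, …, N - 1}`. -/
def fourierFrequencies (N : ℕ) : Set ℝ :=
  {ν | ∃ k : ℕ, k < N ∧ ν = (k : ℝ) / N}

/-- The normalized finite Fourier transform
`ξ_x(ν) = N^{-1/2} ∑_{n=0}^{N-1} x_n exp (-2 i π ν n)` of a vector-valued sequence. -/
def finiteFourier {d : ℕ} (N : ℕ) (x : ℤ → Fin d → ℂ) (ν : ℝ) : Fin d → ℂ :=
  ((Real.sqrt N : ℝ) : ℂ)⁻¹ • ∑ n ∈ Finset.range N, phase ν n • x n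

/-- The `d × (B + 1)` matrix
`Σ_x(ν) = (B + 1)^{-1/2} [ξ_x(ν - B / (2 N)), …, ξ_x(ν + B / (2 N))]`; its columns are indexed
by `j = 0, …, B`, column `j` being at the frequency `ν + b / N` with `b = j - B / 2`. -/
def smoothedFourier {d : ℕ} (N B : ℕ) (x : ℤ → Fin d → ℂ) (ν : ℝ) :
    Matrix (Fin d) (Fin (B + 1)) ℂ :=
  Matrix.of fun i j => ((Real.sqrt ((B : ℝ) + 1) : ℝ) : ℂ)⁻¹ *
    finiteFourier N x (ν + ((j : ℝ) - (B : ℝ) / 2) / N) i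

end

/-! Write `f j` for the frequency of column `j`. Up to the factor `(B + 1)^{-1/2}`, that column of
the error is `(ξ_u(f j) - H(f j) ξ_ε(f j)) + (H(f j) - H(ν)) ξ_ε(f j)`. The first term is an edge
effect: filtering shifts the window `[0, N)` by `k`, which changes at most `2|k|` indices, so its
norm is at most `N^{-1/2} W` with `W = ∑ ‖H_k‖ ∑_{edge} ‖ε_j‖`. The second is at most `π C (B / N)
‖ξ_ε(f j)‖`, because `H` is Lipschitz. Bounding the squared spectral norm by the sum over columns
and applying Parseval gives `2 W² / N + 2 (π C)² (B / N) (T / N)`, where `T = ∑_{n<N} ‖ε_n‖²`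
(`norm_smoothedFourier_sub_sq_le`). Since this does not involve `ν`, the maximum over frequencies
costs nothing.

It remains to send two scalar sequences to zero. With `δ = 1/α - 1`, `1/N = O(M^{-1-δ})` and `B/N =
O(M^{-δ})`. As `𝔼 W²` is bounded, `W² / N` has summable expectations; so has the `q`-th power of `(B
/ N) (T / N)` once `q > 1/δ`. Summable expectations give almost sure convergence whatever the joint
law across `M`. -/

/-! ### Spectral norm by columns, phases and Parseval. -/

/-- Cauchy–Schwarz applied to `A x`, written as a combination of the columns. -/
theorem Matrix.l2_opNorm_sq_le_sum_col {m n : Type*} [Fintype m] [Fintype n] [DecidableEq n]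
    (A : Matrix m n ℂ) :
    ‖A‖ ^ 2 ≤ ∑ j, ‖(WithLp.toLp 2 (fun i => A i j) : EuclideanSpace ℂ m)‖ ^ 2 := by
  have hS : 0 ≤ ∑ j, ‖(WithLp.toLp 2 (fun i => A i j) : EuclideanSpace ℂ m)‖ ^ 2 :=
    Finset.sum_nonneg fun _ _ => by positivity
  refine (Real.le_sqrt (norm_nonneg _) hS).1 ?_
  rw [Matrix.l2_opNorm_def]
  refine ContinuousLinearMap.opNorm_le_bound _ (Real.sqrt_nonneg _) fun x => ?_
  have hx : (toEuclideanLin.trans LinearMap.toContinuousLinearMap) A x =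
      ∑ j, x j • (WithLp.toLp 2 (fun i => A i j) : EuclideanSpace ℂ m) := by
    ext i
    simp [Matrix.mulVec, dotProduct, mul_comm]
  rw [hx]
  refine (norm_sum_le _ _).trans ?_
  simp_rw [norm_smul]
  refine (Real.sum_mul_le_sqrt_mul_sqrt _ _ _).trans_eq ?_
  rw [EuclideanSpace.norm_eq, mul_comm]

theorem phase_add (ν : ℝ) (m n : ℤ) : phase ν (m + n) = phase ν m * phase ν n := by
  rw [phase, phase, phase, ← Complex.exp_add]; congr 1; push_cast; ring

theorem phase_add_left (ν μ : ℝ) (n : ℤ) : phase (ν + μ) n = phase ν n * phase μ n := by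
  rw [phase, phase, phase, ← Complex.exp_add]; congr 1; push_cast; ring

theorem phase_eq_exp_ofReal_mul_I (ν : ℝ) (n : ℤ) :
    phase ν n = Complex.exp ((-(2 * Real.pi * ν * n) : ℝ) * Complex.I) := by
  rw [phase]; congr 1; push_cast; ring

theorem norm_phase (ν : ℝ) (n : ℤ) : ‖phase ν n‖ = 1 := by
  rw [phase_eq_exp_ofReal_mul_I, Complex.norm_exp_ofReal_mul_I]

theorem phase_neg (ν : ℝ) (n : ℤ) : phase ν (-n) = star (phase ν n) := by
  rw [phase_eq_exp_ofReal_mul_I, phase_eq_exp_ofReal_mul_I, Complex.star_def, ← Complex.exp_conj]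
  congr 1; simp [Complex.conj_ofNat]

theorem norm_phase_sub_phase_le (ν μ : ℝ) (n : ℤ) :
    ‖phase ν n - phase μ n‖ ≤ 2 * Real.pi * |ν - μ| * |(n : ℝ)| := by
  have h : phase ν n = phase μ n * phase (ν - μ) n := by rw [← phase_add_left]; congr 1; ring
  have h2 : phase (ν - μ) n =
      Complex.exp (Complex.I * ((-(2 * Real.pi * (ν - μ) * n) : ℝ) : ℂ)) := by
    rw [phase_eq_exp_ofReal_mul_I, mul_comm]
  rw [h, ← mul_sub_one, norm_mul, norm_phase, one_mul, h2]
  refine Real.norm_exp_I_mul_ofReal_sub_one_le.trans_eq ?_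
  rw [Real.norm_eq_abs, abs_neg, abs_mul, abs_mul, abs_of_pos Real.two_pi_pos]

theorem phase_natCast_mul (k : ℕ) (ν : ℝ) (n : ℤ) : phase (k * ν) n = phase ν n ^ k := by
  rw [phase, phase, ← Complex.exp_nat_mul]; congr 1; push_cast; ring

/-- A geometric sum whose ratio is an `N`-th root of unity other than `1`. -/
theorem sum_phase_div_eq_zero {N : ℕ} (hN : 0 < N) {n : ℤ} (hn : ¬ (N : ℤ) ∣ n) :
    ∑ k ∈ Finset.range N, phase ((k : ℝ) / N) n = 0 := by
  have hN' : (N : ℂ) ≠ 0 := by exact_mod_cast hN.ne'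
  have h1 : phase (1 / (N : ℝ)) n ≠ 1 := by
    intro h
    rw [phase, Complex.exp_eq_one_iff] at h
    obtain ⟨m, hm⟩ := h
    apply hn
    refine ⟨-m, ?_⟩
    have : (n : ℂ) = N * (-m) := by
      have hp := Complex.two_pi_I_ne_zero
      push_cast at hm
      field_simp at hm
      linear_combination -hm
    exact_mod_cast this
  have h2 : phase (1 / (N : ℝ)) n ^ N = 1 := by
    rw [← phase_natCast_mul, mul_one_div_cancel (by exact_mod_cast hN.ne'), phase,
      Complex.exp_eq_one_iff]
    exact ⟨-n, by push_cast; ring⟩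
  have h3 : ∀ k : ℕ, phase ((k : ℝ) / N) n = phase (1 / (N : ℝ)) n ^ k := fun k => by
    rw [← phase_natCast_mul, mul_one_div]
  simp_rw [h3]
  rw [geom_sum_eq h1, h2, sub_self, zero_div]

/-- Parseval's identity for the discrete Fourier transform on a shifted frequency grid. -/
theorem sum_norm_sq_sum_phase_mul {N : ℕ} (hN : 0 < N) (θ : ℝ) (y : ℕ → ℂ) :
    ∑ k ∈ Finset.range N, ‖∑ n ∈ Finset.range N, phase (θ + (k : ℝ) / N) n * y n‖ ^ 2 =
      N * ∑ n ∈ Finset.range N, ‖y n‖ ^ 2 := by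
  have hsq : ∀ z : ℂ, ((‖z‖ ^ 2 : ℝ) : ℂ) = z * star z := fun z => by
    rw [Complex.star_def, Complex.mul_conj, Complex.normSq_eq_norm_sq]
  have key : ∀ n ∈ Finset.range N, ∀ m ∈ Finset.range N,
      ∑ k ∈ Finset.range N, phase (θ + (k : ℝ) / N) n * star (phase (θ + (k : ℝ) / N) m) =
        if m = n then (N : ℂ) else 0 := by
    intro n hn m hm
    have h : ∀ k : ℕ, phase (θ + (k : ℝ) / N) n * star (phase (θ + (k : ℝ) / N) m) =
        phase θ (n - m) * phase ((k : ℝ) / N) (n - m) := fun k => by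
      rw [← phase_neg, ← phase_add, ← phase_add_left, sub_eq_add_neg]
    simp_rw [h]
    split_ifs with hmn
    · subst hmn; simp [phase]
    · rw [← Finset.mul_sum, sum_phase_div_eq_zero hN, mul_zero]
      intro hd
      rw [Finset.mem_range] at hn hm
      have := Int.eq_zero_of_abs_lt_dvd hd (by rw [abs_lt]; omega)
      omega
  apply Complex.ofReal_injective
  push_cast
  simp_rw [← Complex.ofReal_pow, hsq, star_sum, Finset.sum_mul_sum, star_mul']
  rw [Finset.sum_comm, Finset.mul_sum]
  refine Finset.sum_congr rfl fun n hn => ?_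
  rw [Finset.sum_comm]
  calc _ = ∑ m ∈ Finset.range N, (y n * star (y m)) *
      ∑ k ∈ Finset.range N, phase (θ + (k : ℝ) / N) n * star (phase (θ + (k : ℝ) / N) m) := by
        refine Finset.sum_congr rfl fun m _ => ?_
        rw [Finset.mul_sum]
        exact Finset.sum_congr rfl fun k _ => by ring
    _ = ∑ m ∈ Finset.range N, (y n * star (y m)) * (if m = n then (N : ℂ) else 0) :=
        Finset.sum_congr rfl fun m hm => by rw [key n hn m hm]
    _ = _ := by
      simp only [mul_ite, mul_zero]
      rw [Finset.sum_ite_eq' , if_pos hn]; ring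

/-- The `B + 1 ≤ N` frequencies begin a full grid of `N` points with spacing `1 / N`; completing the
grid only adds nonnegative terms, and Parseval evaluates the full sum. -/
theorem sum_norm_sq_finiteFourier_le {d N B : ℕ} (hN : 0 < N) (hB : B + 1 ≤ N)
    (x : ℤ → Fin d → ℂ) (ν : ℝ) :
    ∑ j : Fin (B + 1), ‖(WithLp.toLp 2 (finiteFourier N x (ν + ((j : ℝ) - (B : ℝ) / 2) / N)) :
        EuclideanSpace ℂ (Fin d))‖ ^ 2 ≤
      ∑ n ∈ Finset.range N, ‖(WithLp.toLp 2 (x n) : EuclideanSpace ℂ (Fin d))‖ ^ 2 := by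
  have hN' : (0 : ℝ) < N := by exact_mod_cast hN
  simp_rw [EuclideanSpace.norm_sq_eq]
  rw [Finset.sum_comm, Finset.sum_comm (s := Finset.range N)]
  refine Finset.sum_le_sum fun i _ => ?_
  rw [Fin.sum_univ_eq_sum_range (fun j : ℕ =>
    ‖finiteFourier N x (ν + ((j : ℝ) - (B : ℝ) / 2) / N) i‖ ^ 2) (B + 1)]
  refine (Finset.sum_le_sum_of_subset_of_nonneg (Finset.range_mono hB)
    fun _ _ _ => by positivity).trans ?_
  have h : ∀ j : ℕ, ‖finiteFourier N x (ν + ((j : ℝ) - (B : ℝ) / 2) / N) i‖ ^ 2 =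
      (N : ℝ)⁻¹ * ‖∑ n ∈ Finset.range N, phase ((ν - (B : ℝ) / 2 / N) + (j : ℝ) / N) n * x n i‖ ^ 2 := by
    intro j
    have : ν + ((j : ℝ) - (B : ℝ) / 2) / N = (ν - (B : ℝ) / 2 / N) + (j : ℝ) / N := by ring
    rw [this, finiteFourier, Pi.smul_apply, Finset.sum_apply, norm_smul, mul_pow, norm_inv,
      Complex.norm_real, inv_pow, Real.norm_eq_abs, sq_abs, Real.sq_sqrt hN'.le]
    simp
  simp_rw [h]
  rw [← Finset.mul_sum, sum_norm_sq_sum_phase_mul hN _ (fun n => x n i),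
    inv_mul_cancel_left₀ hN'.ne']

/-! ### Regularity of the transfer function and edge windows. -/

section Filter

variable {M K : ℕ} {H : ℤ → Matrix (Fin M) (Fin K) ℂ}

theorem summable_norm_of_memory (hs : Summable fun k : ℤ => (1 + |(k : ℝ)|) * ‖H k‖) :
    Summable fun k : ℤ => ‖H k‖ :=
  hs.of_nonneg_of_le (fun _ => norm_nonneg _) fun k =>
    le_mul_of_one_le_left (norm_nonneg _) (by linarith [abs_nonneg (k : ℝ)])

theorem hasSum_transferFunction (hs : Summable fun k : ℤ => ‖H k‖) (ν : ℝ) :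
    HasSum (fun k => phase ν k • H k) (transferFunction H ν) := by
  have : CompleteSpace (Matrix (Fin M) (Fin K) ℂ) := FiniteDimensional.complete ℂ _
  refine Summable.hasSum (Summable.of_norm ?_)
  simpa only [norm_smul, norm_phase, one_mul] using hs

/-- The phase at lag `k` is Lipschitz in the frequency with constant `2π|k|`; the weight `|k|` in
the memory condition absorbs it. -/
theorem norm_transferFunction_sub_le (hs : Summable fun k : ℤ => (1 + |(k : ℝ)|) * ‖H k‖)
    (ν μ : ℝ) :
    ‖transferFunction H ν - transferFunction H μ‖ ≤
      2 * Real.pi * |ν - μ| * ∑' k : ℤ, (1 + |(k : ℝ)|) * ‖H k‖ := by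
  have hs' := summable_norm_of_memory hs
  have h := (hasSum_transferFunction hs' ν).sub (hasSum_transferFunction hs' μ)
  refine h.norm_le_of_bounded (hs.hasSum.mul_left (2 * Real.pi * |ν - μ|)) fun k => ?_
  rw [← sub_smul, norm_smul, ← mul_assoc]
  refine mul_le_mul_of_nonneg_right ((norm_phase_sub_phase_le ν μ k).trans ?_) (norm_nonneg _)
  have := Real.pi_pos
  gcongr
  linarith

end Filter

/-- The indices lying in exactly one of the windows `[-k, N - k)` and `[0, N)`. -/
noncomputable def edgeIndices (N : ℕ) (k : ℤ) : Finset ℤ :=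
  symmDiff (Finset.Ico (-k) (N - k)) (Finset.Ico 0 (N : ℤ))

theorem card_edgeIndices_le (N : ℕ) (k : ℤ) : ((edgeIndices N k).card : ℝ) ≤ 2 * |(k : ℝ)| := by
  have h : edgeIndices N k ⊆ (Finset.Ico (min 0 (-k)) (max 0 (-k))) ∪
      (Finset.Ico (min (N : ℤ) (N - k)) (max (N : ℤ) (N - k))) := by
    intro j hj
    simp only [edgeIndices, Finset.mem_symmDiff, Finset.mem_union, Finset.mem_Ico] at hj ⊢
    omega
  have h2 := (Finset.card_le_card h).trans (Finset.card_union_le _ _)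
  rw [Int.card_Ico, Int.card_Ico] at h2
  have h3 : ((edgeIndices N k).card : ℤ) ≤ 2 * |k| := by
    rcases abs_cases k with h | h <;> omega
  exact_mod_cast h3

theorem sum_range_intCast_sub {E : Type*} [AddCommMonoid E] (N : ℕ) (g : ℤ → E) (k : ℤ) :
    ∑ n ∈ Finset.range N, g (n - k) = ∑ j ∈ Finset.Ico (-k) (N - k), g j := by
  refine Finset.sum_nbij (fun n : ℕ => (n : ℤ) - k) ?_ ?_ ?_ fun _ _ => rfl
  · intro n hn
    simp only [Finset.mem_range, Finset.mem_Ico] at hn ⊢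
    omega
  · intro a _ b _ h
    simpa using h
  · intro j hj
    simp only [Finset.coe_Ico, Set.mem_Ico] at hj
    exact ⟨(j + k).toNat, by simp only [Finset.coe_range, Set.mem_Iio]; omega,
      by simp only; omega⟩

/-- Terms common to the window and its shift cancel. -/
theorem norm_sum_shift_sub_le {E : Type*} [SeminormedAddCommGroup E] (N : ℕ) (g : ℤ → E) (k : ℤ) :
    ‖∑ n ∈ Finset.range N, (g (n - k) - g n)‖ ≤ ∑ j ∈ edgeIndices N k, ‖g j‖ := by
  have h0 := sum_range_intCast_sub N g 0
  simp only [sub_zero, neg_zero] at h0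
  rw [Finset.sum_sub_distrib, sum_range_intCast_sub, h0, ← Finset.sum_sdiff_sub_sum_sdiff,
    edgeIndices, symmDiff_def, Finset.sup_eq_union, Finset.sum_union disjoint_sdiff_sdiff]
  exact (norm_sub_le _ _).trans (add_le_add (norm_sum_le _ _) (norm_sum_le _ _))

/-! ### Deterministic error bound. -/

section Filtering

variable {M K : ℕ} {H : ℤ → Matrix (Fin M) (Fin K) ℂ} {e : ℤ → Fin K → ℂ} {v : ℤ → Fin M → ℂ}

theorem norm_mulVec_le_l2 (A : Matrix (Fin M) (Fin K) ℂ) (x : Fin K → ℂ) :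
    ‖(WithLp.toLp 2 (A *ᵥ x) : EuclideanSpace ℂ (Fin M))‖ ≤
      ‖A‖ * ‖(WithLp.toLp 2 x : EuclideanSpace ℂ (Fin K))‖ :=
  A.l2_opNorm_mulVec (WithLp.toLp 2 x)

theorem hasSum_convolution
    (hsum : ∀ n, Summable fun k => ‖H k‖ *
      ‖(WithLp.toLp 2 (e (n - k)) : EuclideanSpace ℂ (Fin K))‖)
    (hv : ∀ n, v n = ∑' k, H k *ᵥ e (n - k)) (n : ℤ) :
    HasSum (fun k => H k *ᵥ e (n - k)) (v n) := by
  rw [hv]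
  refine Summable.hasSum ?_
  have h : Summable fun k => (WithLp.toLp 2 (H k *ᵥ e (n - k)) : EuclideanSpace ℂ (Fin M)) :=
    Summable.of_norm_bounded (hsum n) fun k => norm_mulVec_le_l2 _ _
  exact h.map (WithLp.linearEquiv 2 ℂ (Fin M → ℂ)) (PiLp.continuous_ofLp 2 _)

/-- The frequency-domain error made in replacing the linear filter by multiplication with its
transfer function is, up to normalization, a sum involving only the edge indices. -/
theorem hasSum_finiteFourier_sub (hs : Summable fun k : ℤ => ‖H k‖)
    (hsum : ∀ n, Summable fun k => ‖H k‖ *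
      ‖(WithLp.toLp 2 (e (n - k)) : EuclideanSpace ℂ (Fin K))‖)
    (hv : ∀ n, v n = ∑' k, H k *ᵥ e (n - k)) (N : ℕ) (ν : ℝ) :
    HasSum (fun k => ((Real.sqrt N : ℝ) : ℂ)⁻¹ • (phase ν k • H k *ᵥ
        ∑ n ∈ Finset.range N, (phase ν (n - k) • e (n - k) - phase ν n • e n)))
      (finiteFourier N v ν - transferFunction H ν *ᵥ finiteFourier N e ν) := by
  have h1 : HasSum (fun k => ∑ n ∈ Finset.range N, phase ν n • H k *ᵥ e (n - k))
      (∑ n ∈ Finset.range N, phase ν n • v n) :=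
    hasSum_sum fun n _ => (hasSum_convolution hsum hv n).const_smul _
  have h2 : HasSum (fun k => (phase ν k • H k) *ᵥ ∑ n ∈ Finset.range N, phase ν n • e n)
      (transferFunction H ν *ᵥ ∑ n ∈ Finset.range N, phase ν n • e n) :=
    (hasSum_transferFunction hs ν).map
      (Matrix.mulVec.addMonoidHomLeft (∑ n ∈ Finset.range N, phase ν n • e n))
      (continuous_id.matrix_mulVec continuous_const)
  have h3 := (h1.sub h2).const_smul ((Real.sqrt N : ℝ) : ℂ)⁻¹
  have hval : finiteFourier N v ν - transferFunction H ν *ᵥ finiteFourier N e ν =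
      ((Real.sqrt N : ℝ) : ℂ)⁻¹ • (∑ n ∈ Finset.range N, phase ν n • v n -
        transferFunction H ν *ᵥ ∑ n ∈ Finset.range N, phase ν n • e n) := by
    simp only [finiteFourier, Matrix.mulVec_smul, smul_sub]
  rw [hval]
  refine (congrArg (HasSum · _) (funext fun k => ?_)).mp h3
  symm
  congr 1
  rw [Finset.sum_sub_distrib, Matrix.mulVec_sub, smul_sub, Matrix.smul_mulVec]
  congr 1
  rw [Matrix.mulVec_sum, Finset.smul_sum]
  refine Finset.sum_congr rfl fun n _ => ?_
  rw [Matrix.mulVec_smul, smul_smul, ← phase_add, add_sub_cancel]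

/-- Qualitative only: the edge sum is dominated by the sums over both windows. The sharper count
`2|k|` enters later, in expectation. -/
theorem summable_edge
    (hs : Summable fun k : ℤ => ‖H k‖)
    (hsum : ∀ n, Summable fun k => ‖H k‖ *
      ‖(WithLp.toLp 2 (e (n - k)) : EuclideanSpace ℂ (Fin K))‖) (N : ℕ) :
    Summable fun k => ‖H k‖ *
      ∑ j ∈ edgeIndices N k, ‖(WithLp.toLp 2 (e j) : EuclideanSpace ℂ (Fin K))‖ := by
  have h1 : Summable fun k => ∑ n ∈ Finset.range N, ‖H k‖ *
      ‖(WithLp.toLp 2 (e (n - k)) : EuclideanSpace ℂ (Fin K))‖ :=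
    summable_sum fun (n : ℕ) _ => hsum n
  have h2 : Summable fun k => ‖H k‖ * ∑ n ∈ Finset.range N,
      ‖(WithLp.toLp 2 (e n) : EuclideanSpace ℂ (Fin K))‖ := hs.mul_right _
  refine (h1.add h2).of_nonneg_of_le (fun k => by positivity) fun k => ?_
  rw [← Finset.mul_sum, ← mul_add]
  refine mul_le_mul_of_nonneg_left ?_ (norm_nonneg _)
  have h0 := sum_range_intCast_sub N
    (fun j => ‖(WithLp.toLp 2 (e j) : EuclideanSpace ℂ (Fin K))‖) 0
  have hk := sum_range_intCast_sub N
    (fun j => ‖(WithLp.toLp 2 (e j) : EuclideanSpace ℂ (Fin K))‖) k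
  simp only [sub_zero, neg_zero] at h0 hk
  rw [h0, hk, edgeIndices, symmDiff_def, Finset.sup_eq_union,
    Finset.sum_union disjoint_sdiff_sdiff]
  exact add_le_add
    (Finset.sum_le_sum_of_subset_of_nonneg Finset.sdiff_subset fun _ _ _ => norm_nonneg _)
    (Finset.sum_le_sum_of_subset_of_nonneg Finset.sdiff_subset fun _ _ _ => norm_nonneg _)

/-- Phases have modulus one, so they disappear from the norms and the bound is uniform in `ν`. -/
theorem norm_finiteFourier_sub_le (hs : Summable fun k : ℤ => ‖H k‖)
    (hsum : ∀ n, Summable fun k => ‖H k‖ *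
      ‖(WithLp.toLp 2 (e (n - k)) : EuclideanSpace ℂ (Fin K))‖)
    (hv : ∀ n, v n = ∑' k, H k *ᵥ e (n - k)) (N : ℕ) (ν : ℝ) :
    ‖(WithLp.toLp 2 (finiteFourier N v ν - transferFunction H ν *ᵥ finiteFourier N e ν) :
        EuclideanSpace ℂ (Fin M))‖ ≤
      (Real.sqrt N)⁻¹ * ∑' k, ‖H k‖ *
        ∑ j ∈ edgeIndices N k, ‖(WithLp.toLp 2 (e j) : EuclideanSpace ℂ (Fin K))‖ := by
  have h := (hasSum_finiteFourier_sub hs hsum hv N ν).map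
    (WithLp.linearEquiv 2 ℂ (Fin M → ℂ)).symm (PiLp.continuous_toLp 2 _)
  refine h.norm_le_of_bounded ((summable_edge hs hsum N).hasSum.mul_left _) fun k => ?_
  simp only [Function.comp_apply, map_smul, norm_smul, norm_phase, one_mul, norm_inv,
    Complex.norm_real, Real.norm_eq_abs, abs_of_nonneg (Real.sqrt_nonneg _)]
  refine mul_le_mul_of_nonneg_left ?_ (by positivity)
  refine (norm_mulVec_le_l2 _ _).trans (mul_le_mul_of_nonneg_left ?_ (norm_nonneg _))
  have hg := norm_sum_shift_sub_le N
    (fun n => (WithLp.toLp 2 (phase ν n • e n) : EuclideanSpace ℂ (Fin K))) k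
  simp only [WithLp.toLp_smul, norm_smul, norm_phase, one_mul] at hg
  rw [WithLp.toLp_sum]
  simpa only [WithLp.toLp_sub, WithLp.toLp_smul] using hg

/-- Deterministic bound on the error of the frequency-domain factorization. -/
theorem norm_smoothedFourier_sub_sq_le {C : ℝ}
    (hs : Summable fun k : ℤ => (1 + |(k : ℝ)|) * ‖H k‖)
    (hC : ∑' k : ℤ, (1 + |(k : ℝ)|) * ‖H k‖ ≤ C)
    (hsum : ∀ n, Summable fun k => ‖H k‖ *
      ‖(WithLp.toLp 2 (e (n - k)) : EuclideanSpace ℂ (Fin K))‖)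
    (hv : ∀ n, v n = ∑' k, H k *ᵥ e (n - k)) {N B : ℕ} (hN : 0 < N) (hB : B + 1 ≤ N) (ν : ℝ) :
    ‖smoothedFourier N B v ν - transferFunction H ν * smoothedFourier N B e ν‖ ^ 2 ≤
      2 * ((∑' k, ‖H k‖ * ∑ j ∈ edgeIndices N k,
          ‖(WithLp.toLp 2 (e j) : EuclideanSpace ℂ (Fin K))‖) ^ 2 / N) +
        2 * (Real.pi * C) ^ 2 * (B / N * ((∑ n ∈ Finset.range N,
          ‖(WithLp.toLp 2 (e n) : EuclideanSpace ℂ (Fin K))‖ ^ 2) / N)) := by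
  have hs' := summable_norm_of_memory hs
  set W := ∑' k, ‖H k‖ * ∑ j ∈ edgeIndices N k,
          ‖(WithLp.toLp 2 (e j) : EuclideanSpace ℂ (Fin K))‖ with hW
  set T := ∑ n ∈ Finset.range N, ‖(WithLp.toLp 2 (e n) : EuclideanSpace ℂ (Fin K))‖ ^ 2 with hT
  have hN' : (0 : ℝ) < N := by exact_mod_cast hN
  have hB' : (0 : ℝ) < (B : ℝ) + 1 := by positivity
  have hC0 : 0 ≤ C := le_trans (tsum_nonneg fun k => by positivity) hC
  have hT0 : 0 ≤ T := Finset.sum_nonneg fun _ _ => by positivity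
  set f : Fin (B + 1) → ℝ := fun j => ν + ((j : ℝ) - (B : ℝ) / 2) / N with hf
  have hfreq : ∀ j, |f j - ν| ≤ B / (2 * N) := by
    intro j
    have hj : ((j : ℕ) : ℝ) ≤ B := by exact_mod_cast Nat.lt_succ_iff.1 j.2
    have hj0 : (0 : ℝ) ≤ ((j : ℕ) : ℝ) := Nat.cast_nonneg _
    rw [hf]
    simp only [add_sub_cancel_left]
    rw [abs_div, abs_of_pos hN', ← div_div]
    gcongr
    rw [abs_le]
    constructor <;> linarith
  have hcol : ∀ j, ‖(WithLp.toLp 2 (fun i => (smoothedFourier N B v ν -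
        transferFunction H ν * smoothedFourier N B e ν) i j) : EuclideanSpace ℂ (Fin M))‖ ^ 2 ≤
      ((B : ℝ) + 1)⁻¹ * (2 * (W ^ 2 / N) + 2 * (Real.pi * C * (B / N)) ^ 2 *
        ‖(WithLp.toLp 2 (finiteFourier N e (f j)) : EuclideanSpace ℂ (Fin K))‖ ^ 2) := by
    intro j
    -- Insert `H(f j) ξ_e(f j)` to separate the edge error from the variation of `H` over the
    -- smoothing span.
    have hdecomp : (WithLp.toLp 2 (fun i => (smoothedFourier N B v ν -
        transferFunction H ν * smoothedFourier N B e ν) i j) : EuclideanSpace ℂ (Fin M)) =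
        ((Real.sqrt ((B : ℝ) + 1) : ℝ) : ℂ)⁻¹ •
          ((WithLp.toLp 2 (finiteFourier N v (f j) -
              transferFunction H (f j) *ᵥ finiteFourier N e (f j)) : EuclideanSpace ℂ (Fin M)) +
            WithLp.toLp 2 ((transferFunction H (f j) - transferFunction H ν) *ᵥ
              finiteFourier N e (f j))) := by
      rw [← WithLp.toLp_add, Matrix.sub_mulVec, sub_add_sub_cancel, ← WithLp.toLp_smul]
      congr 1
      funext i
      simp only [smoothedFourier, Matrix.sub_apply, Matrix.of_apply, Matrix.mul_apply,
        Pi.smul_apply, Pi.sub_apply, smul_eq_mul, mul_sub, Matrix.mulVec, dotProduct,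
        Finset.mul_sum, hf]
      congr 1
      exact Finset.sum_congr rfl fun k _ => by ring
    rw [hdecomp, norm_smul, mul_pow, norm_inv, Complex.norm_real, inv_pow, Real.norm_eq_abs,
      sq_abs, Real.sq_sqrt hB'.le]
    refine mul_le_mul_of_nonneg_left ?_ (by positivity)
    have h1 := norm_finiteFourier_sub_le hs' hsum hv N (f j)
    rw [← hW] at h1
    have h2 : ‖(WithLp.toLp 2 ((transferFunction H (f j) - transferFunction H ν) *ᵥ
              finiteFourier N e (f j)) : EuclideanSpace ℂ (Fin M))‖ ≤
        (Real.pi * C * (B / N)) *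
          ‖(WithLp.toLp 2 (finiteFourier N e (f j)) : EuclideanSpace ℂ (Fin K))‖ := by
      refine (norm_mulVec_le_l2 _ _).trans (mul_le_mul_of_nonneg_right ?_ (norm_nonneg _))
      refine (norm_transferFunction_sub_le hs _ _).trans ?_
      have hpi := Real.pi_pos
      calc 2 * Real.pi * |f j - ν| * ∑' k : ℤ, (1 + |(k : ℝ)|) * ‖H k‖
          ≤ 2 * Real.pi * (B / (2 * N)) * C := by
            have := hfreq j
            gcongr
        _ = _ := by field_simp
    have h3 : ((Real.sqrt N)⁻¹ * W) ^ 2 = W ^ 2 / N := by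
      rw [mul_pow, inv_pow, Real.sq_sqrt hN'.le]; ring
    calc _ ≤ ((Real.sqrt N)⁻¹ * W + (Real.pi * C * (B / N)) *
          ‖(WithLp.toLp 2 (finiteFourier N e (f j)) : EuclideanSpace ℂ (Fin K))‖) ^ 2 :=
          pow_le_pow_left₀ (norm_nonneg _) ((norm_add_le _ _).trans (add_le_add h1 h2)) 2
      _ ≤ 2 * (((Real.sqrt N)⁻¹ * W) ^ 2 + ((Real.pi * C * (B / N)) *
          ‖(WithLp.toLp 2 (finiteFourier N e (f j)) : EuclideanSpace ℂ (Fin K))‖) ^ 2) :=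
          add_sq_le
      _ = _ := by rw [h3]; ring
  refine (Matrix.l2_opNorm_sq_le_sum_col _).trans ((Finset.sum_le_sum fun j _ => hcol j).trans ?_)
  rw [← Finset.mul_sum, Finset.sum_add_distrib, Finset.sum_const,
    Finset.card_univ, Fintype.card_fin, nsmul_eq_mul, ← Finset.mul_sum]
  have hP : ∑ j, ‖(WithLp.toLp 2 (finiteFourier N e (f j)) : EuclideanSpace ℂ (Fin K))‖ ^ 2 ≤ T :=
    sum_norm_sq_finiteFourier_le hN hB e ν
  -- One factor `B / N` of the squared Lipschitz term absorbs the normalization `1 / (B + 1)`,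
  -- leaving `1 / N` to average `T`.
  have hBN : (B : ℝ) / (B + 1) ≤ 1 := (div_le_one hB').2 (by linarith)
  calc _ ≤ ((B : ℝ) + 1)⁻¹ * (((B + 1 : ℕ) : ℝ) * (2 * (W ^ 2 / N)) +
        2 * (Real.pi * C * (B / N)) ^ 2 * T) := by gcongr
    _ = 2 * (W ^ 2 / N) + 2 * (Real.pi * C) ^ 2 * (B / N * (T / N)) * ((B : ℝ) / (B + 1)) := by
        push_cast; field_simp
    _ ≤ _ := by
        have : 0 ≤ 2 * (Real.pi * C) ^ 2 * (B / N * (T / N)) := by positivity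
        nlinarith

end Filtering
-- Moments and almost sure convergence.
open scoped ENNReal

section Moments

variable {Ω : Type*} [MeasurableSpace Ω] {P : Measure Ω}

theorem isGaussian_complexGaussian (v : ℝ≥0) : IsGaussian (complexGaussian v) :=
  isGaussian_map_equiv (μ := (gaussianReal 0 (v / 2)).prod (gaussianReal 0 (v / 2)))
    Complex.equivRealProdCLM.symm

/-- The Euclidean norm is at most the sum of the coordinate moduli; Minkowski then reduces to the
standard scalar law. -/
theorem lintegral_enorm_pow_le_of_isComplexGaussianVector {K : ℕ} {x : Ω → Fin K → ℂ}
    (hx : Measurable x) (h : IsComplexGaussianVector x 1 P) {q : ℕ} (hq : 1 ≤ q) :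
    ∫⁻ ω, ‖(WithLp.toLp 2 (x ω) : EuclideanSpace ℂ (Fin K))‖ₑ ^ q ∂P ≤
      (K * eLpNorm id q (complexGaussian 1)) ^ q := by
  have hcoord : ∀ i, eLpNorm (fun ω => x ω i) q P = eLpNorm id q (complexGaussian 1) := by
    intro i
    have hi := h (Pi.single i 1)
    have h1 : (star (Pi.single i 1 : Fin K → ℂ) ⬝ᵥ
        (1 : Matrix (Fin K) (Fin K) ℂ) *ᵥ Pi.single i 1).re.toNNReal = 1 := by
      simp
    have h2 : (fun ω => star (Pi.single i 1 : Fin K → ℂ) ⬝ᵥ x ω) = fun ω => x ω i := by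
      funext ω
      simp
    rw [h1, h2] at hi
    rw [← hi.map_eq, eLpNorm_map_measure aestronglyMeasurable_id hi.aemeasurable]
    rfl
  have hq0 : (q : ℝ≥0∞) ≠ 0 := by exact_mod_cast (by omega : q ≠ 0)
  have hmeas : ∀ i, AEStronglyMeasurable (fun ω => ‖x ω i‖) P := fun i =>
    (((measurable_pi_apply i).comp hx).norm).aestronglyMeasurable
  have hle : eLpNorm (fun ω => (WithLp.toLp 2 (x ω) : EuclideanSpace ℂ (Fin K))) q P ≤
      K * eLpNorm id q (complexGaussian 1) := by
    calc _ ≤ eLpNorm (∑ i, fun ω => ‖x ω i‖) q P := by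
          refine eLpNorm_mono_real fun ω => ?_
          rw [Finset.sum_apply, EuclideanSpace.norm_eq]
          refine Real.sqrt_le_iff.2 ⟨Finset.sum_nonneg fun _ _ => norm_nonneg _, ?_⟩
          exact Finset.sum_sq_le_sq_sum_of_nonneg fun _ _ => norm_nonneg _
      _ ≤ ∑ i, eLpNorm (fun ω => ‖x ω i‖) q P :=
          eLpNorm_sum_le (fun i _ => hmeas i) (by exact_mod_cast hq)
      _ = _ := by simp [eLpNorm_norm, hcoord]
  calc _ = eLpNorm (fun ω => (WithLp.toLp 2 (x ω) : EuclideanSpace ℂ (Fin K))) q P ^ q := by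
        rw [eLpNorm_eq_lintegral_rpow_enorm_toReal hq0 (ENNReal.natCast_ne_top q),
          ← ENNReal.rpow_natCast, ← ENNReal.rpow_mul]
        simp only [ENNReal.toReal_natCast, ENNReal.rpow_natCast]
        rw [one_div_mul_cancel (by exact_mod_cast (by omega : q ≠ 0)), ENNReal.rpow_one]
    _ ≤ _ := by gcongr

/-- The point is the order of quantifiers: `m` serves every noise, hence all `M` and `n` at once. -/
theorem exists_forall_lintegral_enorm_pow_le (K : ℕ) (P : Measure Ω) {q : ℕ} (hq : 1 ≤ q) :
    ∃ m : ℝ≥0, ∀ ε : ℤ → Ω → Fin K → ℂ, IsComplexGaussianWhiteNoise ε P → ∀ n,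
      ∫⁻ ω, ‖(WithLp.toLp 2 (ε n ω) : EuclideanSpace ℂ (Fin K))‖ₑ ^ q ∂P ≤ m := by
  have := isGaussian_complexGaussian 1
  have hfin : (K * eLpNorm id q (complexGaussian 1)) ^ q ≠ ∞ :=
    ENNReal.pow_ne_top (ENNReal.mul_ne_top (ENNReal.natCast_ne_top K)
      (IsGaussian.memLp_id _ q (ENNReal.natCast_ne_top q)).eLpNorm_ne_top)
  refine ⟨((K * eLpNorm id q (complexGaussian 1)) ^ q).toNNReal, fun ε hε n => ?_⟩
  rw [ENNReal.coe_toNNReal hfin]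
  exact lintegral_enorm_pow_le_of_isComplexGaussianVector (hε.measurable n) (hε.gaussian n) hq

theorem ENNReal.mul_le_sq_add_sq (a b : ℝ≥0∞) : a * b ≤ a ^ 2 + b ^ 2 := by
  rcases le_total a b with h | h
  · calc a * b ≤ b * b := by gcongr
      _ = b ^ 2 := (sq b).symm
      _ ≤ _ := le_add_self
  · calc a * b ≤ a * a := by gcongr
      _ = a ^ 2 := (sq a).symm
      _ ≤ _ := le_self_add

/-- Expand the square as a double series, exchange by Tonelli, and bound each mixed moment through
`a b ≤ a² + b²`. -/
theorem lintegral_tsum_mul_sum_sq_le {ι κ : Type*} [Countable ι] {a : κ → Ω → ℝ≥0∞}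
    (ha : ∀ n, Measurable (a n)) {m : ℝ≥0∞} (hm : ∀ n, ∫⁻ ω, a n ω ^ 2 ∂P ≤ m)
    (w : ι → ℝ≥0∞) (s : ι → Finset κ) :
    ∫⁻ ω, (∑' k, w k * ∑ j ∈ s k, a j ω) ^ 2 ∂P ≤ 2 * m * (∑' k, w k * (s k).card) ^ 2 := by
  have hZ : ∀ k, Measurable fun ω => ∑ j ∈ s k, a j ω := fun k =>
    Finset.measurable_sum _ fun j _ => ha j
  have haa : ∀ i j, Measurable fun ω => a i ω * a j ω := fun i j => (ha i).mul (ha j)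
  have hZm : ∀ k l, Measurable fun ω => (∑ i ∈ s k, a i ω) * ∑ j ∈ s l, a j ω := fun k l =>
    (hZ k).mul (hZ l)
  have hpair : ∀ i j, ∫⁻ ω, a i ω * a j ω ∂P ≤ 2 * m := fun i j => by
    calc _ ≤ ∫⁻ ω, a i ω ^ 2 + a j ω ^ 2 ∂P :=
          lintegral_mono fun ω => ENNReal.mul_le_sq_add_sq _ _
      _ = ∫⁻ ω, a i ω ^ 2 ∂P + ∫⁻ ω, a j ω ^ 2 ∂P := lintegral_add_left ((ha i).pow_const 2) _
      _ ≤ m + m := add_le_add (hm i) (hm j)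
      _ = 2 * m := (two_mul m).symm
  have hZZ : ∀ k l, ∫⁻ ω, (∑ i ∈ s k, a i ω) * (∑ j ∈ s l, a j ω) ∂P ≤
      (s k).card * ((s l).card * (2 * m)) := fun k l => by
    simp_rw [Finset.sum_mul_sum]
    rw [lintegral_finsetSum _ fun i _ => Finset.measurable_sum _ fun j _ => haa i j,
      ← nsmul_eq_mul]
    refine Finset.sum_le_card_nsmul _ _ _ fun i _ => ?_
    rw [lintegral_finsetSum _ fun j _ => haa i j, ← nsmul_eq_mul]
    exact Finset.sum_le_card_nsmul _ _ _ fun j _ => hpair i j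
  calc _ = ∫⁻ ω, ∑' k, ∑' l, w k * w l * ((∑ i ∈ s k, a i ω) * ∑ j ∈ s l, a j ω) ∂P := by
        refine lintegral_congr fun ω => ?_
        rw [sq, ← ENNReal.tsum_mul_right]
        refine tsum_congr fun k => ?_
        rw [← ENNReal.tsum_mul_left]
        exact tsum_congr fun l => by ring
    _ = ∑' k, ∑' l, w k * w l * ∫⁻ ω, (∑ i ∈ s k, a i ω) * ∑ j ∈ s l, a j ω ∂P := by
        rw [lintegral_tsum fun k => (Measurable.tsum fun l =>
          (hZm k l).const_mul _).aemeasurable]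
        refine tsum_congr fun k => ?_
        rw [lintegral_tsum fun l => ((hZm k l).const_mul _).aemeasurable]
        exact tsum_congr fun l => lintegral_const_mul _ (hZm k l)
    _ ≤ ∑' k, ∑' l, w k * w l * ((s k).card * ((s l).card * (2 * m))) :=
        ENNReal.tsum_le_tsum fun k => ENNReal.tsum_le_tsum fun l => by gcongr; exact hZZ k l
    _ = _ := by
        rw [sq, ← ENNReal.tsum_mul_right, ← ENNReal.tsum_mul_left]
        refine tsum_congr fun k => ?_
        rw [← ENNReal.tsum_mul_left, ← ENNReal.tsum_mul_left]
        exact tsum_congr fun l => by ring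

/-- Jensen's inequality for the uniform average, integrated. -/
theorem lintegral_mean_pow_le {a : ℕ → Ω → ℝ≥0∞} (ha : ∀ n, Measurable (a n)) {m : ℝ≥0∞}
    {q : ℕ} (hq : 1 ≤ q) (hm : ∀ n, ∫⁻ ω, a n ω ^ q ∂P ≤ m) {N : ℕ} (hN : 0 < N) :
    ∫⁻ ω, ((∑ n ∈ Finset.range N, a n ω) / N) ^ q ∂P ≤ m := by
  have hN0 : (N : ℝ≥0∞) ≠ 0 := by exact_mod_cast hN.ne'
  have hw : ∑ _n ∈ Finset.range N, (N : ℝ≥0∞)⁻¹ = 1 := by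
    rw [Finset.sum_const, Finset.card_range, nsmul_eq_mul,
      ENNReal.mul_inv_cancel hN0 (ENNReal.natCast_ne_top N)]
  calc _ ≤ ∫⁻ ω, ∑ n ∈ Finset.range N, (N : ℝ≥0∞)⁻¹ * a n ω ^ q ∂P := by
        refine lintegral_mono fun ω => ?_
        have h := ENNReal.rpow_arith_mean_le_arith_mean_rpow (Finset.range N)
          (fun _ => (N : ℝ≥0∞)⁻¹) (fun n => a n ω) hw (p := q) (by exact_mod_cast hq)
        simp only [ENNReal.rpow_natCast] at h
        rwa [← Finset.mul_sum, mul_comm, ← div_eq_mul_inv] at h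
    _ = ∑ n ∈ Finset.range N, (N : ℝ≥0∞)⁻¹ * ∫⁻ ω, a n ω ^ q ∂P := by
        rw [lintegral_finsetSum _ fun n _ => ((ha n).pow_const q).const_mul _]
        exact Finset.sum_congr rfl fun n _ => lintegral_const_mul _ ((ha n).pow_const q)
    _ ≤ ∑ n ∈ Finset.range N, (N : ℝ≥0∞)⁻¹ * m :=
        Finset.sum_le_sum fun n _ => by gcongr; exact hm n
    _ = m := by rw [← Finset.sum_mul, hw, one_mul]

/-- A sequence of nonnegative random variables with summable expectations tends to zero almost
surely. -/
theorem ae_tendsto_zero_of_eventually_lintegral_le {f : ℕ → Ω → ℝ≥0∞}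
    (hf : ∀ M, AEMeasurable (f M) P) {r : ℕ → ℝ} (hr : Summable r)
    (h : ∀ᶠ M in atTop, ∫⁻ ω, f M ω ∂P ≤ ENNReal.ofReal (r M)) :
    ∀ᵐ ω ∂P, Tendsto (fun M => f M ω) atTop (𝓝 0) := by
  obtain ⟨M₀, hM₀⟩ := eventually_atTop.1 h
  have hfin : ∫⁻ ω, ∑' M, f (M + M₀) ω ∂P ≠ ∞ := by
    rw [lintegral_tsum fun M => hf _]
    refine ne_top_of_le_ne_top ?_ (ENNReal.tsum_le_tsum fun M => hM₀ (M + M₀) (by omega))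
    exact ((summable_nat_add_iff M₀).2 hr).tsum_ofReal_ne_top
  filter_upwards [ae_lt_top' (AEMeasurable.tsum fun M => hf _) hfin] with ω hω
  exact (tendsto_add_atTop_iff_nat M₀).1 (ENNReal.tendsto_atTop_zero_of_tsum_ne_top hω.ne)

theorem ae_summable_norm_mul {E F : Type*} [NormedAddCommGroup E] [NormedAddCommGroup F]
    {ι : Type*} [Countable ι] {h : ι → E} (hs : Summable fun k => ‖h k‖) {x : ι → Ω → F}
    (hx : ∀ k, Measurable fun ω => ‖x k ω‖ₑ) {m : ℝ≥0} (hm : ∀ k, ∫⁻ ω, ‖x k ω‖ₑ ∂P ≤ m) :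
    ∀ᵐ ω ∂P, Summable fun k => ‖h k‖ * ‖x k ω‖ := by
  have hfin : ∫⁻ ω, ∑' k, ‖h k‖ₑ * ‖x k ω‖ₑ ∂P ≠ ∞ := by
    rw [lintegral_tsum fun k => ((hx k).const_mul _).aemeasurable]
    refine ne_top_of_le_ne_top (b := (∑' k, ‖h k‖ₑ) * m) (ENNReal.mul_ne_top ?_ ENNReal.coe_ne_top)
      ?_
    · simpa only [ofReal_norm] using hs.tsum_ofReal_ne_top
    · rw [← ENNReal.tsum_mul_right]
      refine ENNReal.tsum_le_tsum fun k => ?_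
      rw [lintegral_const_mul _ (hx k)]
      gcongr
      exact hm k
  filter_upwards [ae_lt_top' (Measurable.tsum fun k =>
    (hx k).const_mul _).aemeasurable hfin] with ω hω
  have := ENNReal.summable_toReal hω.ne
  simpa using this

end Moments

/-! ### Growth rates in the high-dimensional regime. -/

/-- Inverting `M ≤ A N^α` gives `1/N ≤ A^{1/α} M^{-1/α}`, and eventually `B ≤ (2/c) M`. -/
theorem HighDimensionalRegime.exists_rate {N B : ℕ → ℕ} (h : HighDimensionalRegime N B) :
    ∃ δ : ℝ, 0 < δ ∧ ∃ C : ℝ, 0 < C ∧ ∀ᶠ M : ℕ in atTop, 0 < N M ∧ B M + 1 ≤ N M ∧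
      ((N M : ℝ))⁻¹ ≤ C * (M : ℝ) ^ (-(1 + δ)) ∧ (B M : ℝ) / N M ≤ C * (M : ℝ) ^ (-δ) := by
  obtain ⟨α, hα0, hα1, hO⟩ := h.sample_size
  obtain ⟨c, hc0, -, hc⟩ := h.ratio
  obtain ⟨A, hA0, hA⟩ := hO.exists_pos
  set δ := 1 / α - 1 with hδ
  have hδ0 : 0 < δ := by rw [hδ, sub_pos, lt_div_iff₀ hα0]; linarith
  have hαδ : 1 + δ = 1 / α := by rw [hδ]; ring
  have hA' : 0 < A ^ (1 / α) := by positivity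
  set C := max (A ^ (1 / α)) (2 / c * A ^ (1 / α)) with hC
  have hC0 : 0 < C := lt_max_of_lt_left hA'
  have hlim : Tendsto (fun M : ℕ => C * (M : ℝ) ^ (-(1 + δ)) + C * (M : ℝ) ^ (-δ)) atTop
      (𝓝 (C * 0 + C * 0)) :=
    (((tendsto_rpow_neg_atTop (by linarith : 0 < 1 + δ)).comp tendsto_natCast_atTop_atTop).const_mul
      C).add (((tendsto_rpow_neg_atTop hδ0).comp tendsto_natCast_atTop_atTop).const_mul C)
  -- This sum bounds `1/N + B/N`, so it yields `B + 1 ≤ N`.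
  have hlim1 : ∀ᶠ M : ℕ in atTop, C * (M : ℝ) ^ (-(1 + δ)) + C * (M : ℝ) ^ (-δ) < 1 :=
    hlim.eventually_lt_const (by norm_num)
  refine ⟨δ, hδ0, C, hC0, ?_⟩
  filter_upwards [hA.bound, hc.eventually_const_lt (half_lt_self hc0), hlim1,
    eventually_ge_atTop 1] with M hM hMB hM1 hM0
  have hMpos : (0 : ℝ) < M := by exact_mod_cast hM0
  rw [Real.norm_of_nonneg hMpos.le, Real.norm_of_nonneg (by positivity)] at hM
  have hNpos : 0 < N M := by
    rcases Nat.eq_zero_or_pos (N M) with h0 | h0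
    · rw [h0, Nat.cast_zero, Real.zero_rpow hα0.ne', mul_zero] at hM
      linarith
    · exact h0
  have hN : (0 : ℝ) < N M := by exact_mod_cast hNpos
  have hinv : ((N M : ℝ))⁻¹ ≤ A ^ (1 / α) * (M : ℝ) ^ (-(1 + δ)) := by
    have h1 : (M : ℝ) ^ (1 / α) ≤ A ^ (1 / α) * N M := by
      calc (M : ℝ) ^ (1 / α) ≤ (A * (N M : ℝ) ^ α) ^ (1 / α) := by gcongr
        _ = _ := by
          rw [Real.mul_rpow hA0.le (by positivity), ← Real.rpow_mul hN.le,
            mul_one_div_cancel hα0.ne', Real.rpow_one]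
    rw [hαδ, Real.rpow_neg hMpos.le, ← div_eq_mul_inv, inv_le_iff_one_le_mul₀ hN,
      div_mul_eq_mul_div, one_le_div (by positivity)]
    exact h1
  have hBpos : (0 : ℝ) < B M := by
    rcases Nat.eq_zero_or_pos (B M) with h0 | h0
    · rw [h0, Nat.cast_zero, div_zero] at hMB
      linarith
    · exact_mod_cast h0
  have hB : (B M : ℝ) ≤ 2 / c * M := by
    rw [lt_div_iff₀ hBpos] at hMB
    rw [div_mul_eq_mul_div, le_div_iff₀ hc0]
    linarith
  have hBN : (B M : ℝ) / N M ≤ 2 / c * A ^ (1 / α) * (M : ℝ) ^ (-δ) := by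
    calc (B M : ℝ) / N M ≤ (2 / c * M) * (A ^ (1 / α) * (M : ℝ) ^ (-(1 + δ))) := by
          rw [div_eq_mul_inv]; gcongr
      _ = 2 / c * A ^ (1 / α) * ((M : ℝ) ^ (1 : ℝ) * (M : ℝ) ^ (-(1 + δ))) := by
          rw [Real.rpow_one]; ring
      _ = _ := by rw [← Real.rpow_add hMpos]; congr 2; ring
  have h1 : ((N M : ℝ))⁻¹ ≤ C * (M : ℝ) ^ (-(1 + δ)) :=
    hinv.trans (mul_le_mul_of_nonneg_right (le_max_left _ _) (by positivity))
  have h2 : (B M : ℝ) / N M ≤ C * (M : ℝ) ^ (-δ) :=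
    hBN.trans (mul_le_mul_of_nonneg_right (le_max_right _ _) (by positivity))
  refine ⟨hNpos, ?_, h1, h2⟩
  have h3 : ((B M : ℝ) + 1) / N M ≤ 1 := by
    rw [add_div, one_div]; linarith
  rw [div_le_one hN] at h3
  exact_mod_cast h3

/-! ### Almost sure limits for the noise. -/

section Noise

variable {Ω : Type*} [MeasurableSpace Ω] {P : Measure Ω} {K : ℕ}

theorem IsComplexGaussianWhiteNoise.measurable_enorm {ε : ℤ → Ω → Fin K → ℂ}
    (h : IsComplexGaussianWhiteNoise ε P) (n : ℤ) :
    Measurable fun ω => ‖(WithLp.toLp 2 (ε n ω) : EuclideanSpace ℂ (Fin K))‖ₑ :=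
  ((WithLp.measurable_toLp 2 _).comp (h.measurable n)).enorm

theorem ae_tendsto_edge_sum_sq {N B : ℕ → ℕ} (hregime : HighDimensionalRegime N B)
    {H : (M : ℕ) → ℤ → Matrix (Fin M) (Fin K) ℂ} (hH : MIMOFilterConditions H)
    {ε : ℕ → ℤ → Ω → Fin K → ℂ} (hε : ∀ M, IsComplexGaussianWhiteNoise (ε M) P) :
    ∀ᵐ ω ∂P, Tendsto (fun M => (∑' k, ‖H M k‖ₑ * ∑ j ∈ edgeIndices (N M) k,
      ‖(WithLp.toLp 2 (ε M j ω) : EuclideanSpace ℂ (Fin K))‖ₑ) ^ 2 / (N M : ℝ≥0∞))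
      atTop (𝓝 0) := by
  obtain ⟨δ, hδ, C, hC, hrate⟩ := hregime.exists_rate
  obtain ⟨A, hA⟩ := hH.memory
  obtain ⟨m, hm⟩ := exists_forall_lintegral_enorm_pow_le K P (q := 2) (by norm_num)
  have hmeas : ∀ M, Measurable fun ω => (∑' k, ‖H M k‖ₑ * ∑ j ∈ edgeIndices (N M) k,
      ‖(WithLp.toLp 2 (ε M j ω) : EuclideanSpace ℂ (Fin K))‖ₑ) ^ 2 := fun M =>
    (Measurable.tsum fun k => (Finset.measurable_sum _ fun j _ =>
      (hε M).measurable_enorm j).const_mul _).pow_const 2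
  have hsummable : Summable fun M : ℕ => 2 * (m : ℝ) * (2 * A) ^ 2 * (C * (M : ℝ) ^ (-(1 + δ))) :=
    ((Real.summable_nat_rpow.2 (by linarith)).mul_left C).mul_left _
  refine ae_tendsto_zero_of_eventually_lintegral_le
    (fun M => ((hmeas M).div_const _).aemeasurable) hsummable ?_
  filter_upwards [hrate, eventually_ge_atTop 1] with M ⟨hN, _, hNinv, _⟩ hM1
  obtain ⟨hs, hsA⟩ := hA M hM1
  have hA0 : 0 ≤ A := le_trans (tsum_nonneg fun k => by positivity) hsA
  -- Edge sets have at most `2|k|` elements, so the memory condition bounds the weighted count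
  -- uniformly in `M`.
  have hw : ∑' k, ‖H M k‖ₑ * ((edgeIndices (N M) k).card : ℝ≥0∞) ≤ ENNReal.ofReal (2 * A) := by
    calc _ ≤ ∑' k : ℤ, ENNReal.ofReal (2 * ((1 + |(k : ℝ)|) * ‖H M k‖)) := by
          refine ENNReal.tsum_le_tsum fun k => ?_
          rw [← ofReal_norm, ← ENNReal.ofReal_natCast, ← ENNReal.ofReal_mul (norm_nonneg _)]
          refine ENNReal.ofReal_le_ofReal ?_
          have := card_edgeIndices_le (N M) k
          have := norm_nonneg (H M k)
          nlinarith
      _ = ENNReal.ofReal (∑' k : ℤ, 2 * ((1 + |(k : ℝ)|) * ‖H M k‖)) :=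
          (ENNReal.ofReal_tsum_of_nonneg (fun k => by positivity) (hs.mul_left 2)).symm
      _ ≤ _ := by
          rw [tsum_mul_left]
          exact ENNReal.ofReal_le_ofReal (by linarith)
  have hN' : (0 : ℝ) < N M := by exact_mod_cast hN
  simp_rw [div_eq_mul_inv]
  rw [lintegral_mul_const _ (hmeas M)]
  calc _ ≤ 2 * (m : ℝ≥0∞) * ENNReal.ofReal (2 * A) ^ 2 * (N M : ℝ≥0∞)⁻¹ := by
        gcongr
        refine (lintegral_tsum_mul_sum_sq_le (fun n => (hε M).measurable_enorm n)
          (hm (ε M) (hε M)) _ _).trans ?_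
        gcongr
    _ = ENNReal.ofReal (2 * (m : ℝ) * (2 * A) ^ 2 * (N M : ℝ)⁻¹) := by
        rw [ENNReal.ofReal_mul (p := 2 * (m : ℝ) * (2 * A) ^ 2) (by positivity),
          ENNReal.ofReal_mul (p := 2 * (m : ℝ)) (by positivity),
          ENNReal.ofReal_mul (p := 2) (q := (m : ℝ)) (by positivity), ENNReal.ofReal_pow (by positivity),
          ENNReal.ofReal_inv_of_pos hN', ENNReal.ofReal_natCast, ENNReal.ofReal_coe_nnreal,
          ENNReal.ofReal_ofNat]
    _ ≤ _ := by
        refine ENNReal.ofReal_le_ofReal ?_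
        gcongr

theorem ae_tendsto_mul_mean_sq {N B : ℕ → ℕ} (hregime : HighDimensionalRegime N B)
    {ε : ℕ → ℤ → Ω → Fin K → ℂ} (hε : ∀ M, IsComplexGaussianWhiteNoise (ε M) P) :
    ∀ᵐ ω ∂P, Tendsto (fun M => ENNReal.ofReal (B M / N M) * ((∑ n ∈ Finset.range (N M),
      ‖(WithLp.toLp 2 (ε M n ω) : EuclideanSpace ℂ (Fin K))‖ₑ ^ 2) / (N M : ℝ≥0∞)))
      atTop (𝓝 0) := by
  obtain ⟨δ, hδ, C, hC, hrate⟩ := hregime.exists_rate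
  -- `B/N` decays only like `M^{-δ}`, possibly not summably; the power `q > 1/δ` makes `M^{-δ q}`
  -- summable.
  obtain ⟨q, hq⟩ := exists_nat_gt (1 / δ)
  have hq0 : 0 < q := by
    have : (0 : ℝ) < q := lt_trans (by positivity) hq
    exact_mod_cast this
  have hqδ : 1 < δ * q := by
    rw [div_lt_iff₀ hδ] at hq
    linarith
  obtain ⟨m, hm⟩ := exists_forall_lintegral_enorm_pow_le K P (q := 2 * q) (by omega)
  have hmeas : ∀ M n, Measurable fun ω =>
      ‖(WithLp.toLp 2 (ε M n ω) : EuclideanSpace ℂ (Fin K))‖ₑ ^ 2 := fun M n =>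
    ((hε M).measurable_enorm n).pow_const 2
  have hmeas' : ∀ M, Measurable fun ω => ((∑ n ∈ Finset.range (N M),
      ‖(WithLp.toLp 2 (ε M n ω) : EuclideanSpace ℂ (Fin K))‖ₑ ^ 2) / (N M : ℝ≥0∞)) := fun M =>
    (Finset.measurable_sum _ fun (n : ℕ) _ => hmeas M n).div_const _
  have hsummable : Summable fun M : ℕ => C ^ q * (M : ℝ) ^ (-(δ * q)) * (m : ℝ) :=
    ((Real.summable_nat_rpow.2 (by linarith)).mul_left _).mul_right _
  have key := ae_tendsto_zero_of_eventually_lintegral_le (P := P)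
    (f := fun M ω => (ENNReal.ofReal (B M / N M) * ((∑ n ∈ Finset.range (N M),
      ‖(WithLp.toLp 2 (ε M n ω) : EuclideanSpace ℂ (Fin K))‖ₑ ^ 2) / (N M : ℝ≥0∞))) ^ q)
    (fun M => (((hmeas' M).const_mul _).pow_const q).aemeasurable) hsummable ?_
  · filter_upwards [key] with ω hω
    -- Return from the `q`-th power by a continuous `q`-th root.
    have h := ((ENNReal.continuous_rpow_const (y := 1 / (q : ℝ))).tendsto 0).comp hω
    rw [ENNReal.zero_rpow_of_pos (by positivity)] at h
    refine h.congr fun M => ?_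
    simp only [Function.comp_apply]
    rw [← ENNReal.rpow_natCast, ← ENNReal.rpow_mul, mul_one_div_cancel (by positivity),
      ENNReal.rpow_one]
  · filter_upwards [hrate, eventually_ge_atTop 1] with M ⟨hN, _, _, hBN⟩ hM1
    have hM0 : (0 : ℝ) < M := by exact_mod_cast hM1
    simp_rw [mul_pow]
    rw [lintegral_const_mul _ ((hmeas' M).pow_const q)]
    calc _ ≤ ENNReal.ofReal (B M / N M) ^ q * (m : ℝ≥0∞) := by
          gcongr
          refine lintegral_mean_pow_le (fun n => hmeas M n) hq0 (fun n => ?_) hN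
          simpa only [← pow_mul] using hm (ε M) (hε M) n
      _ = ENNReal.ofReal ((B M / N M : ℝ) ^ q * m) := by
          rw [ENNReal.ofReal_mul (by positivity), ENNReal.ofReal_pow (by positivity),
            ENNReal.ofReal_coe_nnreal]
      _ ≤ _ := by
          refine ENNReal.ofReal_le_ofReal ?_
          rw [← neg_mul, Real.rpow_mul hM0.le, Real.rpow_natCast, ← mul_pow]
          gcongr

theorem ae_summable_filter {M : ℕ} {H : ℤ → Matrix (Fin M) (Fin K) ℂ}
    (hs : Summable fun k => ‖H k‖) {ε : ℤ → Ω → Fin K → ℂ}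
    (hε : IsComplexGaussianWhiteNoise ε P) :
    ∀ᵐ ω ∂P, ∀ n, Summable fun k => ‖H k‖ *
      ‖(WithLp.toLp 2 (ε (n - k) ω) : EuclideanSpace ℂ (Fin K))‖ := by
  obtain ⟨m, hm⟩ := exists_forall_lintegral_enorm_pow_le K P (q := 1) le_rfl
  simp only [pow_one] at hm
  exact ae_all_iff.2 fun n => ae_summable_norm_mul hs
    (fun k => hε.measurable_enorm (n - k)) fun k => hm ε hε (n - k)

end Noise

/-! ### Conclusion. -/

theorem norm_smoothedFourier_sub_le_sqrt {M K : ℕ} {H : ℤ → Matrix (Fin M) (Fin K) ℂ}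
    {e : ℤ → Fin K → ℂ} {v : ℤ → Fin M → ℂ} {C : ℝ}
    (hs : Summable fun k : ℤ => (1 + |(k : ℝ)|) * ‖H k‖)
    (hC : ∑' k : ℤ, (1 + |(k : ℝ)|) * ‖H k‖ ≤ C)
    (hsum : ∀ n, Summable fun k => ‖H k‖ *
      ‖(WithLp.toLp 2 (e (n - k)) : EuclideanSpace ℂ (Fin K))‖)
    (hv : ∀ n, v n = ∑' k, H k *ᵥ e (n - k)) {N B : ℕ} (hN : 0 < N) (hB : B + 1 ≤ N) (ν : ℝ) :
    ‖smoothedFourier N B v ν - transferFunction H ν * smoothedFourier N B e ν‖ ≤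
      √(2 * ((∑' k, ‖H k‖ₑ * ∑ j ∈ edgeIndices N k,
          ‖(WithLp.toLp 2 (e j) : EuclideanSpace ℂ (Fin K))‖ₑ) ^ 2 / (N : ℝ≥0∞)).toReal +
        2 * (Real.pi * C) ^ 2 * (ENNReal.ofReal (B / N) * ((∑ n ∈ Finset.range N,
          ‖(WithLp.toLp 2 (e n) : EuclideanSpace ℂ (Fin K))‖ₑ ^ 2) / (N : ℝ≥0∞))).toReal) := by
  refine Real.le_sqrt_of_sq_le
    ((norm_smoothedFourier_sub_sq_le hs hC hsum hv hN hB ν).trans_eq ?_)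
  simp only [ENNReal.toReal_div, ENNReal.toReal_pow, ENNReal.toReal_mul, ENNReal.toReal_natCast]
  -- Termwise finiteness suffices: for an infinite total, both sides would take the default value
  -- `0`.
  rw [ENNReal.tsum_toReal_eq fun k => ENNReal.mul_ne_top enorm_ne_top
      (ENNReal.sum_ne_top.2 fun j _ => enorm_ne_top),
    ENNReal.toReal_sum fun n _ => ENNReal.pow_ne_top enorm_ne_top,
    ENNReal.toReal_ofReal (by positivity)]
  simp only [ENNReal.toReal_mul, ENNReal.toReal_pow, toReal_enorm,
    ENNReal.toReal_sum fun j _ => enorm_ne_top]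

theorem mainTheorem5 {Ω : Type*} [MeasurableSpace Ω] (P : Measure Ω) [IsProbabilityMeasure P]
    (K : ℕ) (N B : ℕ → ℕ) (hregime : HighDimensionalRegime N B)
    (H : (M : ℕ) → ℤ → Matrix (Fin M) (Fin K) ℂ) (hH : MIMOFilterConditions H)
    (ε : ℕ → ℤ → Ω → Fin K → ℂ) (hε : ∀ M, IsComplexGaussianWhiteNoise (ε M) P)
    (u : (M : ℕ) → ℤ → Ω → Fin M → ℂ)
    (hu : ∀ M n, ∀ᵐ ω ∂P, u M n ω = ∑' k : ℤ, H M k *ᵥ ε M (n - k) ω) :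
    ∀ᵐ ω ∂P, Tendsto
      (fun M : ℕ => ⨆ ν : fourierFrequencies (N M),
        ‖smoothedFourier (N M) (B M) (fun n => u M n ω) ν -
          transferFunction (H M) ν * smoothedFourier (N M) (B M) (fun n => ε M n ω) ν‖)
      atTop (𝓝 0) := by
  obtain ⟨C, hC⟩ := hH.memory
  obtain ⟨δ, -, C', -, hrate⟩ := hregime.exists_rate
  have hsummable : ∀ᵐ ω ∂P, ∀ M : ℕ, 1 ≤ M → ∀ n, Summable fun k => ‖H M k‖ *
      ‖(WithLp.toLp 2 (ε M (n - k) ω) : EuclideanSpace ℂ (Fin K))‖ :=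
    ae_all_iff.2 fun M => eventually_imp_distrib_left.2 fun hM =>
      ae_summable_filter (summable_norm_of_memory (hC M hM).1) (hε M)
  have hu' : ∀ᵐ ω ∂P, ∀ M n, u M n ω = ∑' k : ℤ, H M k *ᵥ ε M (n - k) ω :=
    ae_all_iff.2 fun M => ae_all_iff.2 fun n => hu M n
  filter_upwards [hsummable, hu', ae_tendsto_edge_sum_sq hregime hH hε,
    ae_tendsto_mul_mean_sq hregime hε] with ω hsum huω hedge hmean
  have hedge' := (ENNReal.tendsto_toReal ENNReal.zero_ne_top).comp hedge
  have hmean' := (ENNReal.tendsto_toReal ENNReal.zero_ne_top).comp hmean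
  have hbound := ((hedge'.const_mul 2).add
    (hmean'.const_mul (2 * (Real.pi * C) ^ 2))).sqrt
  simp only [ENNReal.toReal_zero, mul_zero, add_zero, Real.sqrt_zero] at hbound
  refine tendsto_of_tendsto_of_tendsto_of_le_of_le' tendsto_const_nhds hbound
    (Eventually.of_forall fun M => Real.iSup_nonneg fun ν => norm_nonneg _) ?_
  filter_upwards [hrate, eventually_ge_atTop 1] with M ⟨hN, hB, _, _⟩ hM1
  exact Real.iSup_le (fun ν => norm_smoothedFourier_sub_le_sqrt (e := fun n => ε M n ω)
    (v := fun n => u M n ω) (hC M hM1).1 (hC M hM1).2 (hsum M hM1) (huω M) hN hB ν)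
    (Real.sqrt_nonneg _)
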